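/- For a metric space $X$, let $\dim_H X$ denote its Hausdorff dimension, with the convention $\dim_H\emptyset=-1$. The $n$th inductive topological Hausdorff dimension is defined by $\dim_{t^nH}\emptyset=-1$ for all $n\in\mathbb N=\{0,1,2,\dots\}$ and, for $X\neq\emptyset$, by $\dim_{t^0H}X=\dim_H X$ and, for $n\ge 1$, $$\dim_{t^nH}X=\inf\{d : X \text{ has a basis } \mathcal U \text{ of open sets such that } \dim_{t^{n-1}H}\partial U\le d-1 \text{ for every } U\in\mathcal U\},$$ where $d=\infty$ is allowed with $\infty-1=\infty$, and $\partial U$ is the boundary of $U$ with the subspace metric. The product of two metric spaces carries the metric $\sqrt{d_X^2+d_Y^2}$, the cube $[0,1]^k$ carries the Euclidean metric, and $[0,1]^0=\{0\}$. Let $X$ be a non-empty separable metric space and let $n,k\in\mathbb N$ with $n\le k$. Then $$\dim_{t^nH}\left(X\times[0,1]^k\right)=\dim_H\left(X\times[0,1]^k\right)=\dim_H X+k,$$ where the values may be $\infty$. -/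

import Mathlib

open Classical in
/-- Hausdorff dimension of a metric space, with the convention that the empty space has
dimension `-1`. -/
noncomputable def hausdorffDim (X : Type*) [MetricSpace X] : EReal :=
  if IsEmpty X then -1 else ((dimH (Set.univ : Set X) : ENNReal) : EReal)

open Classical in
/-- The `n`th inductive topological Hausdorff dimension of a metric space; boundaries carry the
subspace metric. In `EReal` one has `⊤ - 1 = ⊤`, so `d = ⊤` always belongs to the set below. -/
noncomputable def inductiveTopHausdorffDim : ℕ → (X : Type*) → [MetricSpace X] → EReal
  | 0, X, _ => hausdorffDim X
  | n + 1, X, _ =>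
    if IsEmpty X then -1
    else sInf {d : EReal | ∃ 𝒰 : Set (Set X), TopologicalSpace.IsTopologicalBasis 𝒰 ∧
      ∀ U ∈ 𝒰, inductiveTopHausdorffDim n (frontier U) ≤ d - 1}

/-- The cube `[0,1]^k` with the Euclidean metric (a single point for `k = 0`). -/
abbrev UnitCube (k : ℕ) : Type := PiLp 2 (fun _ : Fin k => Set.Icc (0 : ℝ) 1)

/-- The `l²`-product of two metric spaces. -/
abbrev L2Prod (X Y : Type*) : Type _ := WithLp 2 (X × Y)

/-! Everything follows from the chain `dim_H X + k ≤ dim_{t^kH} ≤ dim_{t^nH} ≤ dim_H ≤ dim_H X + k`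
for the product of `X` with the cube.

The first inequality is the heart. If `dim_{t^kH} < d`, a countable basis and induction split the
product into `k` zero-dimensional sets `C i` and a set `A` with `dim_H A ≤ d - k`
(`exists_isZeroDimensional_decomposition`). Each `C i` is covered by disjoint open neighbourhoods of
the two `i`th faces. In every fibre `{x} × [0,1]^k` these `k` pairs of open sets leave a point
uncovered (`exists_forall_notMem_of_separate_faces`, from Kuhn's cubical lemma), and that point lies
in `A`. So `A` projects onto `X`; the projection is 1-Lipschitz, whence `dim_H X ≤ d - k`.

The dimensions decrease in `n` because almost every sphere about a point has Hausdorff dimension at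
least one less than the space. The last inequality comes from cutting covers of `X` times the cube
into small cells. -/

section ZeroDimensional

open Set Topology

/-! ### Zero-dimensional sets and the countable sum theorem -/

/-- A set `C` is zero-dimensional if every cover of `C` by two open sets can be refined to a cover
by two open sets that are disjoint on `C`. -/
def IsZeroDimensional {Z : Type*} [TopologicalSpace Z] (C : Set Z) : Prop :=
  ∀ O P : Set Z, IsOpen O → IsOpen P → C ⊆ O ∪ P →
    ∃ U V : Set Z, IsOpen U ∧ IsOpen V ∧ U ⊆ O ∧ V ⊆ P ∧ C ⊆ U ∪ V ∧ ∀ z ∈ C, z ∈ U → z ∉ V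

theorem IsZeroDimensional.inter_isClosed {Z : Type*} [TopologicalSpace Z] {C K : Set Z}
    (hC : IsZeroDimensional C) (hK : IsClosed K) : IsZeroDimensional (C ∩ K) := by
  intro O P hO hP hOP
  obtain ⟨U, V, hU, hV, hUO, hVP, hUV, hd⟩ := hC (O ∪ Kᶜ) P (hO.union hK.isOpen_compl) hP (by
    intro z hz
    by_cases hzK : z ∈ K
    · rcases hOP ⟨hz, hzK⟩ with h | h
      · exact Or.inl (Or.inl h)
      · exact Or.inr h
    · exact Or.inl (Or.inr hzK))
  refine ⟨U ∩ O, V, hU.inter hO, hV, inter_subset_right, hVP, ?_, fun z hz hzU => hd z hz.1 hzU.1⟩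
  rintro z ⟨hz, hzK⟩
  rcases hUV hz with h | h
  · rcases hUO h with h' | h'
    · exact Or.inl ⟨h, h'⟩
    · exact absurd hzK h'
  · exact Or.inr h

theorem Topology.IsInducing.isZeroDimensional_image {Y Z : Type*} [TopologicalSpace Y]
    [TopologicalSpace Z] {f : Y → Z} (hf : IsInducing f) {C : Set Y} :
    IsZeroDimensional (f '' C) ↔ IsZeroDimensional C := by
  constructor
  · intro h O P hO hP hOP
    obtain ⟨O', hO', rfl⟩ := hf.isOpen_iff.1 hO
    obtain ⟨P', hP', rfl⟩ := hf.isOpen_iff.1 hP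
    obtain ⟨U, V, hU, hV, hUO, hVP, hUV, hd⟩ := h O' P' hO' hP' (by
      rintro _ ⟨y, hy, rfl⟩
      exact hOP hy)
    exact ⟨f ⁻¹' U, f ⁻¹' V, hU.preimage hf.continuous, hV.preimage hf.continuous,
      preimage_mono hUO, preimage_mono hVP, fun y hy => hUV (mem_image_of_mem f hy),
      fun y hy => hd (f y) (mem_image_of_mem f hy)⟩
  · intro h O P hO hP hOP
    obtain ⟨U, V, hU, hV, hUO, hVP, hUV, hd⟩ := h (f ⁻¹' O) (f ⁻¹' P)
      (hO.preimage hf.continuous) (hP.preimage hf.continuous)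
      (fun y hy => hOP (mem_image_of_mem f hy))
    obtain ⟨U', hU', rfl⟩ := hf.isOpen_iff.1 hU
    obtain ⟨V', hV', rfl⟩ := hf.isOpen_iff.1 hV
    refine ⟨U' ∩ O, V' ∩ P, hU'.inter hO, hV'.inter hP, inter_subset_right, inter_subset_right,
      ?_, ?_⟩
    · rintro _ ⟨y, hy, rfl⟩
      rcases hUV hy with h | h
      · exact Or.inl ⟨h, hUO h⟩
      · exact Or.inr ⟨h, hVP h⟩
    · rintro _ ⟨y, hy, rfl⟩ h h'
      exact hd y hy h.1 h'.1

/-- The complement of the boundaries of a countable basis is zero-dimensional. -/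
theorem TopologicalSpace.IsTopologicalBasis.isZeroDimensional_compl_iUnion_frontier {Z : Type*}
    [TopologicalSpace Z] {B : ℕ → Set Z} (hB : IsTopologicalBasis (range B)) :
    IsZeroDimensional (⋃ j, frontier (B j))ᶜ := by
  intro O P hO hP hOP
  have hBo : ∀ j, IsOpen (B j) := fun j => hB.isOpen (mem_range_self j)
  let J : Set ℕ := {j | B j ⊆ O ∨ B j ⊆ P}
  -- Off the frontiers `closure (B i)` and `B i` agree, so a point there survives in `W j` for the
  -- first `j ∈ J` with `B j` containing it.
  let W : ℕ → Set Z := fun j => B j \ ⋃ i ∈ {i | i < j ∧ i ∈ J}, closure (B i)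
  have hWo : ∀ j, IsOpen (W j) := fun j => (hBo j).sdiff
    (((finite_lt_nat j).subset fun i hi => hi.1).isClosed_biUnion fun i _ => isClosed_closure)
  have hWd : ∀ i j z, i ∈ J → i < j → z ∈ W i → z ∉ W j := fun i j z hi hij hzi hzj =>
    hzj.2 (mem_iUnion₂.2 ⟨i, ⟨hij, hi⟩, subset_closure hzi.1⟩)
  refine ⟨⋃ j ∈ {j | B j ⊆ O}, W j, ⋃ j ∈ {j | ¬ B j ⊆ O ∧ B j ⊆ P}, W j,
    isOpen_biUnion fun j _ => hWo j, isOpen_biUnion fun j _ => hWo j,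
    iUnion₂_subset fun j hj => sdiff_subset.trans hj,
    iUnion₂_subset fun j hj => sdiff_subset.trans hj.2, ?_, ?_⟩
  · intro z hz
    have hex : ∃ j, j ∈ J ∧ z ∈ B j := by
      rcases hOP hz with h | h
      · obtain ⟨_, ⟨j, rfl⟩, hzj, hj⟩ := hB.exists_subset_of_mem_open h hO
        exact ⟨j, Or.inl hj, hzj⟩
      · obtain ⟨_, ⟨j, rfl⟩, hzj, hj⟩ := hB.exists_subset_of_mem_open h hP
        exact ⟨j, Or.inr hj, hzj⟩
    classical
    have hmem : z ∈ W (Nat.find hex) := by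
      refine ⟨(Nat.find_spec hex).2, fun h => ?_⟩
      obtain ⟨i, ⟨hi, hiJ⟩, hzi⟩ := mem_iUnion₂.1 h
      refine Nat.find_min hex hi ⟨hiJ, ?_⟩
      by_contra hzB
      exact hz (mem_iUnion.2 ⟨i, hzi, fun h => hzB (interior_subset h)⟩)
    by_cases hO' : B (Nat.find hex) ⊆ O
    · exact Or.inl (mem_iUnion₂.2 ⟨_, hO', hmem⟩)
    · exact Or.inr (mem_iUnion₂.2 ⟨_, ⟨hO', (Nat.find_spec hex).1.resolve_left hO'⟩, hmem⟩)
  · intro z _ hU hV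
    obtain ⟨i, hi, hzi⟩ := mem_iUnion₂.1 hU
    obtain ⟨j, hj, hzj⟩ := mem_iUnion₂.1 hV
    rcases lt_trichotomy i j with h | rfl | h
    · exact hWd i j z (Or.inl hi) h hzi hzj
    · exact hj.1 hi
    · exact hWd j i z (Or.inr hj.2) h hzj hzi

/-- Two disjoint closed sets can be enlarged to disjoint closed sets that cover a given closed
zero-dimensional set. -/
theorem IsZeroDimensional.exists_enlargement {Y : Type*} [TopologicalSpace Y] [NormalSpace Y]
    {D E H : Set Y} (hD : IsZeroDimensional D) (hDc : IsClosed D) (hE : IsClosed E)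
    (hH : IsClosed H) (hEH : Disjoint E H) :
    ∃ E' H' : Set Y, IsClosed E' ∧ IsClosed H' ∧ Disjoint E' H' ∧ E ⊆ interior E' ∧
      H ⊆ interior H' ∧ D ⊆ E' ∪ H' := by
  obtain ⟨U, V, hU, hV, hUH, hVE, hUV, hd⟩ := hD Hᶜ Eᶜ hH.isOpen_compl hE.isOpen_compl (by
    intro z _
    by_cases hz : z ∈ H
    · exact Or.inr fun h => disjoint_left.1 hEH h hz
    · exact Or.inl hz)
  -- `U` and `V` split `D` into the relatively clopen parts `D \ V` and `D \ U`, closed in the whole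
  -- space since `D` is.
  have hdis : Disjoint (E ∪ D \ V) (H ∪ D \ U) := by
    refine disjoint_left.2 ?_
    rintro z (hz | hz) (hz' | hz')
    · exact disjoint_left.1 hEH hz hz'
    · exact hVE ((hUV hz'.1).resolve_left hz'.2) hz
    · exact hUH ((hUV hz.1).resolve_right hz.2) hz'
    · exact ((hUV hz.1).resolve_right hz.2 |> hz'.2)
  obtain ⟨O, P, hO, hP, hEO, hHP, hOP⟩ := normal_separation (hE.union (hDc.sdiff hV))
    (hH.union (hDc.sdiff hU)) hdis
  obtain ⟨O', hO', hEO', hO'O⟩ := normal_exists_closure_subset (hE.union (hDc.sdiff hV)) hO hEO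
  obtain ⟨P', hP', hHP', hP'P⟩ := normal_exists_closure_subset (hH.union (hDc.sdiff hU)) hP hHP
  refine ⟨closure O', closure P', isClosed_closure, isClosed_closure, hOP.mono hO'O hP'P,
    subset_union_left.trans (hEO'.trans (interior_maximal subset_closure hO')),
    subset_union_left.trans (hHP'.trans (interior_maximal subset_closure hP')), fun z hz => ?_⟩
  by_cases hzV : z ∈ V
  · have : z ∉ U := fun h => hd z hz h hzV
    exact Or.inr (subset_closure (hHP' (Or.inr ⟨hz, this⟩)))
  · exact Or.inl (subset_closure (hEO' (Or.inr ⟨hz, hzV⟩)))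

/-- Starting from `Pᶜ` and `Oᶜ`, enlarge two disjoint closed sets step by step, absorbing `K i` at
stage `i`. Each stage lies in the interior of the next, so the unions are open, and they stay
disjoint. -/
theorem isZeroDimensional_univ_of_iUnion_isClosed {Y : Type*} [TopologicalSpace Y] [NormalSpace Y]
    {K : ℕ → Set Y} (hK : ∀ i, IsClosed (K i)) (hKu : ⋃ i, K i = univ)
    (hz : ∀ i, IsZeroDimensional (K i)) : IsZeroDimensional (univ : Set Y) := by
  intro O P hO hP hOP
  let T := {p : Set Y × Set Y // IsClosed p.1 ∧ IsClosed p.2 ∧ Disjoint p.1 p.2}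
  have step : ∀ (i : ℕ) (p : T), ∃ q : T, p.1.1 ⊆ interior q.1.1 ∧ p.1.2 ⊆ interior q.1.2 ∧
      K i ⊆ q.1.1 ∪ q.1.2 := by
    rintro i ⟨⟨E, H⟩, hE, hH, hEH⟩
    obtain ⟨E', H', h1, h2, h3, h4, h5, h6⟩ := (hz i).exists_enlargement (hK i) hE hH hEH
    exact ⟨⟨⟨E', H'⟩, h1, h2, h3⟩, h4, h5, h6⟩
  choose g hg1 hg2 hg3 using step
  let p0 : T := ⟨(Pᶜ, Oᶜ), hP.isClosed_compl, hO.isClosed_compl, disjoint_left.2 fun z hz hz' =>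
    (hOP (mem_univ z)).elim hz' hz⟩
  let s : ℕ → T := fun n => Nat.rec p0 g n
  have hs1 : ∀ n, (s n).1.1 ⊆ interior (s (n + 1)).1.1 := fun n => hg1 n (s n)
  have hs2 : ∀ n, (s n).1.2 ⊆ interior (s (n + 1)).1.2 := fun n => hg2 n (s n)
  have hm1 : Monotone fun n => (s n).1.1 :=
    monotone_nat_of_le_succ fun n => (hs1 n).trans interior_subset
  have hm2 : Monotone fun n => (s n).1.2 :=
    monotone_nat_of_le_succ fun n => (hs2 n).trans interior_subset
  have hdis : ∀ m n z, z ∈ (s m).1.1 → z ∉ (s n).1.2 := fun m n z h h' =>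
    disjoint_left.1 (s (max m n)).2.2.2 (hm1 (le_max_left m n) h) (hm2 (le_max_right m n) h')
  refine ⟨⋃ n, interior (s n).1.1, ⋃ n, interior (s n).1.2, isOpen_iUnion fun n => isOpen_interior,
    isOpen_iUnion fun n => isOpen_interior, ?_, ?_, ?_, ?_⟩
  · refine iUnion_subset fun n z hz => ?_
    by_contra hzO
    exact hdis n 0 z (interior_subset hz) hzO
  · refine iUnion_subset fun n z hz => ?_
    by_contra hzP
    exact hdis 0 n z hzP (interior_subset hz)
  · intro z _
    obtain ⟨i, hi⟩ := mem_iUnion.1 (hKu.symm ▸ mem_univ z : z ∈ ⋃ i, K i)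
    rcases hg3 i (s i) hi with h | h
    -- `K i` is absorbed at stage `i + 1`, hence lies in the interiors at stage `i + 2`.
    · exact Or.inl (mem_iUnion.2 ⟨i + 2, hs1 (i + 1) h⟩)
    · exact Or.inr (mem_iUnion.2 ⟨i + 2, hs2 (i + 1) h⟩)
  · intro z _ h h'
    obtain ⟨m, hm⟩ := mem_iUnion.1 h
    obtain ⟨n, hn⟩ := mem_iUnion.1 h'
    exact hdis m n z (interior_subset hm) (interior_subset hn)

/-- The countable closed sum theorem in dimension zero. -/
theorem isZeroDimensional_of_iUnion_isClosed {Z ι : Type*} [TopologicalSpace Z]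
    [CompletelyNormalSpace Z] [Countable ι] [Nonempty ι] {D : Set Z} {K : ι → Set Z}
    (hK : ∀ i, IsClosed (K i)) (hDK : D ⊆ ⋃ i, K i) (hz : ∀ i, IsZeroDimensional (D ∩ K i)) :
    IsZeroDimensional D := by
  obtain ⟨e, he⟩ := exists_surjective_nat ι
  -- `D` need not be closed; as a subspace of a completely normal space it is itself normal.
  have hu : IsZeroDimensional (univ : Set D) := by
    refine isZeroDimensional_univ_of_iUnion_isClosed (K := fun i => Subtype.val ⁻¹' K (e i))
      (fun i => (hK _).preimage continuous_subtype_val) ?_ fun i => ?_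
    · refine eq_univ_of_forall fun z => ?_
      obtain ⟨i, hi⟩ := mem_iUnion.1 (hDK z.2)
      obtain ⟨n, rfl⟩ := he i
      exact mem_iUnion.2 ⟨n, hi⟩
    · rw [← IsInducing.subtypeVal.isZeroDimensional_image, Subtype.image_preimage_coe]
      exact hz (e i)
  rw [← IsInducing.subtypeVal.isZeroDimensional_image, image_univ, Subtype.range_coe] at hu
  exact hu

/-- Zero-dimensional subsets of the members of a sequence of closed sets, made disjoint by removing
the previous members of the sequence, have a zero-dimensional union. -/
theorem isZeroDimensional_iUnion_diff {Z : Type*} [MetricSpace Z] {F C : ℕ → Set Z}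
    (hF : ∀ j, IsClosed (F j)) (hCF : ∀ j, C j ⊆ F j) (hC : ∀ j, IsZeroDimensional (C j)) :
    IsZeroDimensional (⋃ j, C j \ ⋃ l ∈ {l | l < j}, F l) := by
  have hcl : ∀ j, IsClosed (⋃ l ∈ {l | l < j}, F l) := fun j =>
    (finite_lt_nat j).isClosed_biUnion fun l _ => hF l
  -- Open sets are `F_σ`; on the closed piece `F j ∩ G j n` the whole union reduces to `C j`.
  choose G hGc hGs hGu _ using fun j => (hcl j).isOpen_compl.exists_iUnion_isClosed
  refine isZeroDimensional_of_iUnion_isClosed (ι := ℕ × ℕ) (K := fun p => F p.1 ∩ G p.1 p.2)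
    (fun p => (hF _).inter (hGc _ _)) ?_ ?_
  · refine iUnion_subset fun j z hz => ?_
    have : z ∈ ⋃ n, G j n := (hGu j).symm ▸ hz.2
    obtain ⟨n, hn⟩ := mem_iUnion.1 this
    exact mem_iUnion.2 ⟨(j, n), hCF j hz.1, hn⟩
  · rintro ⟨j, n⟩
    convert (hC j).inter_isClosed ((hF j).inter (hGc j n)) using 1
    ext z
    constructor
    · rintro ⟨hz, hzF, hzG⟩
      obtain ⟨i, hi, hi'⟩ := mem_iUnion.1 hz
      rcases lt_trichotomy i j with h | rfl | h
      · exact absurd (mem_iUnion₂.2 ⟨i, h, hCF i hi⟩) (hGs j n hzG)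
      · exact ⟨hi, hzF, hzG⟩
      · exact absurd (mem_iUnion₂.2 ⟨j, h, hzF⟩) hi'
    · rintro ⟨hz, hzF, hzG⟩
      exact ⟨mem_iUnion.2 ⟨j, hz, hGs j n hzG⟩, hzF, hzG⟩

/-- Disjoint closed sets have disjoint open neighbourhoods that cover a given zero-dimensional
set. -/
theorem IsZeroDimensional.exists_isOpen_separation {Z : Type*} [TopologicalSpace Z]
    [CompletelyNormalSpace Z] {C A B : Set Z} (hC : IsZeroDimensional C) (hA : IsClosed A)
    (hB : IsClosed B) (hAB : Disjoint A B) :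
    ∃ U V : Set Z, IsOpen U ∧ IsOpen V ∧ Disjoint U V ∧ A ⊆ U ∧ B ⊆ V ∧ C ⊆ U ∪ V := by
  obtain ⟨O, P, hO, hP, hAO, hBP, hOP⟩ := normal_separation hA hB hAB
  obtain ⟨O', hO', hAO', hO'O⟩ := normal_exists_closure_subset hA hO hAO
  obtain ⟨P', hP', hBP', hP'P⟩ := normal_exists_closure_subset hB hP hBP
  have hOP' : Disjoint (closure O') (closure P') := hOP.mono hO'O hP'P
  obtain ⟨U, V, hU, hV, hUP, hVO, hUV, hd⟩ := hC (closure P')ᶜ (closure O')ᶜ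
    isClosed_closure.isOpen_compl isClosed_closure.isOpen_compl (by
    intro z _
    by_cases hz : z ∈ closure P'
    · exact Or.inr fun h => disjoint_left.1 hOP' h hz
    · exact Or.inl hz)
  have h1 : Disjoint (closure (C ∩ U)) (C ∩ V) := by
    refine Disjoint.mono_right inter_subset_right (Disjoint.closure_left ?_ hV)
    exact disjoint_left.2 fun z hz hzV => hd z hz.1 hz.2 hzV
  have h2 : Disjoint (C ∩ U) (closure (C ∩ V)) := by
    refine Disjoint.mono_left inter_subset_right (Disjoint.closure_right ?_ hU)
    exact disjoint_left.2 fun z hzU hz => hd z hz.1 hzU hz.2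
  -- `C ∩ U` and `C ∩ V` are separated but not closed, so complete normality is needed.
  obtain ⟨U', V', hU', hV', hCU, hCV, hUV'⟩ :=
    separatedNhds_iff_disjoint.2 (completely_normal h1 h2)
  refine ⟨(U' ∩ (closure P')ᶜ) ∪ O', (V' ∩ (closure O')ᶜ) ∪ P',
    (hU'.inter isClosed_closure.isOpen_compl).union hO',
    (hV'.inter isClosed_closure.isOpen_compl).union hP', ?_, hAO'.trans subset_union_right,
    hBP'.trans subset_union_right, fun z hz => ?_⟩
  · refine disjoint_left.2 ?_
    rintro z (h | h) (h' | h')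
    · exact disjoint_left.1 hUV' h.1 h'.1
    · exact h.2 (subset_closure h')
    · exact h'.2 (subset_closure h)
    · exact disjoint_left.1 hOP' (subset_closure h) (subset_closure h')
  · rcases hUV hz with h | h
    · exact Or.inl (Or.inl ⟨hCU ⟨hz, h⟩, hUP h⟩)
    · exact Or.inr (Or.inl ⟨hCV ⟨hz, h⟩, hVO h⟩)

/-! ### Decomposition into zero-dimensional sets and a remainder -/

/-- If the `n`th inductive topological Hausdorff dimension of `Z` is less than `d`, then `Z` is the
union of a set of Hausdorff dimension at most `d - n` and of `n` zero-dimensional sets. -/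
theorem exists_isZeroDimensional_decomposition (n : ℕ) :
    ∀ (Z : Type*) [MetricSpace Z] [TopologicalSpace.SeparableSpace Z] (d : ℝ),
      inductiveTopHausdorffDim n Z < d →
      ∃ (A : Set Z) (C : Fin n → Set Z), (∀ i, IsZeroDimensional (C i)) ∧
        A ∪ ⋃ i, C i = univ ∧
        (A.Nonempty → ((dimH A : ENNReal) : EReal) ≤ ((d - n : ℝ) : EReal)) := by
  induction n with
  | zero =>
    intro Z _ _ d hd
    refine ⟨univ, Fin.elim0, fun i => i.elim0, by simp, fun hne => ?_⟩
    have : ¬ IsEmpty Z := by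
      rw [not_isEmpty_iff]
      exact ⟨hne.some⟩
    rw [inductiveTopHausdorffDim, hausdorffDim, if_neg this] at hd
    simpa using hd.le
  | succ n ih =>
    intro Z _ _ d hd
    rcases isEmpty_or_nonempty Z with hZ | hZ
    · exact ⟨∅, fun _ => ∅, fun i O P _ _ _ => ⟨∅, ∅, by simp⟩, Subsingleton.elim _ _, by simp⟩
    rw [inductiveTopHausdorffDim, if_neg (not_isEmpty_iff.2 hZ), sInf_lt_iff] at hd
    obtain ⟨e, ⟨𝒰, h𝒰, hbd⟩, hed⟩ := hd
    have : SecondCountableTopology Z := UniformSpace.secondCountable_of_separable Z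
    obtain ⟨𝒱, h𝒱𝒰, h𝒱c, h𝒱⟩ := h𝒰.exists_countable
    have h𝒱ne : 𝒱.Nonempty := by
      obtain ⟨V, hV, -⟩ := h𝒱.exists_subset_of_mem_open (mem_univ hZ.some) isOpen_univ
      exact ⟨V, hV⟩
    obtain ⟨B, rfl⟩ := h𝒱c.exists_eq_range h𝒱ne
    have hlt : ∀ j, inductiveTopHausdorffDim n (frontier (B j)) < ((d - 1 : ℝ) : EReal) := by
      intro j
      refine (hbd _ (h𝒱𝒰 (mem_range_self j))).trans_lt ?_
      induction e with
      | bot => exact EReal.bot_sub 1 ▸ EReal.bot_lt_coe _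
      | top => simp at hed
      | coe e =>
        have : e < d := by exact_mod_cast hed
        have : e - 1 < d - 1 := by linarith
        exact_mod_cast this
    choose A C hC hAC hA using fun j => ih (frontier (B j)) (d - 1) (hlt j)
    -- The complement of the frontiers is the one new zero-dimensional set; the pieces found inside
    -- the frontiers are merged over `j`.
    refine ⟨⋃ j, Subtype.val '' A j, Fin.cons (⋃ j, frontier (B j))ᶜ
      fun i => ⋃ j, (Subtype.val '' C j i) \ ⋃ l ∈ {l | l < j}, frontier (B l), ?_, ?_, ?_⟩
    · refine Fin.cases ?_ fun i => ?_
      · exact h𝒱.isZeroDimensional_compl_iUnion_frontier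
      · refine isZeroDimensional_iUnion_diff (fun j => isClosed_frontier) (fun j => ?_) fun j => ?_
        · rintro _ ⟨z, _, rfl⟩
          exact z.2
        · exact IsInducing.subtypeVal.isZeroDimensional_image.2 (hC j i)
    · refine eq_univ_of_forall fun z => ?_
      classical
      by_cases hz : ∃ j, z ∈ frontier (B j)
      · have hmem : (⟨z, Nat.find_spec hz⟩ : frontier (B (Nat.find hz))) ∈
            A (Nat.find hz) ∪ ⋃ i, C (Nat.find hz) i := hAC _ ▸ mem_univ _
        rcases hmem with h | h
        · exact Or.inl (mem_iUnion.2 ⟨_, _, h, rfl⟩)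
        · obtain ⟨i, hi⟩ := mem_iUnion.1 h
          refine Or.inr (mem_iUnion.2
            ⟨i.succ, mem_iUnion.2 ⟨Nat.find hz, ⟨_, hi, rfl⟩, fun h' => ?_⟩⟩)
          obtain ⟨l, hl, hzl⟩ := mem_iUnion₂.1 h'
          exact Nat.find_min hz hl hzl
      · exact Or.inr (mem_iUnion.2 ⟨0, fun h => hz (mem_iUnion.1 h)⟩)
    · intro hne
      have hdn : d - 1 - n = d - (n + 1 : ℕ) := by push_cast; ring
      -- `dimH ∅ = 0`, so the real bound is available only for nonempty pieces, and one such piece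
      -- makes it nonnegative.
      have hle : ∀ j, (A j).Nonempty → dimH (A j) ≤ ENNReal.ofReal (d - (n + 1 : ℕ)) ∧
          0 ≤ d - (n + 1 : ℕ) := by
        intro j hj
        have h := hA j hj
        rw [hdn] at h
        have h0 : 0 ≤ d - (n + 1 : ℕ) := by
          have := (EReal.coe_ennreal_nonneg _).trans h
          exact_mod_cast this
        refine ⟨?_, h0⟩
        rw [← EReal.coe_ennreal_le_coe_ennreal_iff, EReal.coe_ennreal_ofReal, max_eq_left h0]
        exact h
      obtain ⟨z, hz⟩ := hne
      obtain ⟨j, y, hy, -⟩ := mem_iUnion.1 hz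
      have h0 := (hle j ⟨y, hy⟩).2
      have : dimH (⋃ j, Subtype.val '' A j) ≤ ENNReal.ofReal (d - (n + 1 : ℕ)) := by
        rw [dimH_iUnion]
        refine iSup_le fun i => ?_
        rw [isometry_subtype_coe.dimH_image]
        rcases (A i).eq_empty_or_nonempty with h | h
        · simp [h]
        · exact (hle i h).1
      rw [← EReal.coe_ennreal_le_coe_ennreal_iff, EReal.coe_ennreal_ofReal, max_eq_left h0] at this
      exact this

/-! ### Kuhn's cubical lemma by counting modulo 2 -/

/-- Sum over the monotone unit-step paths from `p` whose steps use different directions of `S`, one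
step for each function of the list; a path contributes the product of the increments, modulo 2, of
the functions along its steps. -/
def pathSum {ι : Type*} [DecidableEq ι] :
    List ((ι → ℕ) → ZMod 2) → (ι → ℕ) → Finset ι → ZMod 2
  | [], _, _ => 1
  | c :: cs, p, S =>
    ∑ s ∈ S, (c (p + Pi.single s 1) + c p) * pathSum cs (p + Pi.single s 1) (S.erase s)

/-- Sum over the points which agree with `q` off the list `l` and have coordinates less than `N`
on `l`. -/
def boxSum {ι : Type*} [DecidableEq ι] (N : ℕ) :
    List ι → (ι → ℕ) → ((ι → ℕ) → ZMod 2) → ZMod 2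
  | [], q, F => F q
  | i :: l, q, F => ∑ a ∈ Finset.range N, boxSum N l (Function.update q i a) F

section PathSum

variable {ι : Type*} [DecidableEq ι]

theorem sum_erase_eq_zero_of_symm (S : Finset ι) (f : ι → ι → ZMod 2)
    (hf : ∀ s t, f s t = f t s) : ∑ s ∈ S, ∑ t ∈ S.erase s, f s t = 0 := by
  rw [Finset.sum_sigma']
  refine Finset.sum_involution (fun x _ => ⟨x.2, x.1⟩) ?_ ?_ ?_ ?_
  · intro x _
    rw [hf x.2 x.1]
    exact CharTwo.add_self_eq_zero _
  · rintro ⟨s, t⟩ hx _ h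
    simp only [Finset.mem_sigma, Finset.mem_erase] at hx
    exact hx.2.1 (congrArg Sigma.fst h)
  · rintro ⟨s, t⟩ hx
    simp only [Finset.mem_sigma, Finset.mem_erase] at hx ⊢
    exact ⟨hx.2.2, hx.2.1.symm, hx.1⟩
  · rintro ⟨s, t⟩ _
    rfl

theorem sum_erase_comm (S : Finset ι) (f : ι → ι → ZMod 2) :
    ∑ s ∈ S, ∑ t ∈ S.erase s, f s t = ∑ s ∈ S, ∑ t ∈ S.erase s, f t s := by
  refine Finset.sum_comm' fun s t => ?_
  simp only [Finset.mem_erase]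
  tauto

/-- A discrete form of `d(dc₁ ∧ ⋯ ∧ dcₘ) = 0`: the sums over upper and lower faces agree. After
expanding the first step, terms symmetric in two directions cancel modulo 2. -/
theorem sum_pathSum_erase (cs : List ((ι → ℕ) → ZMod 2)) : ∀ (p : ι → ℕ) (S : Finset ι),
    ∑ s ∈ S, pathSum cs (p + Pi.single s 1) (S.erase s) =
      ∑ s ∈ S, pathSum cs p (S.erase s) := by
  induction cs with
  | nil => intro p S; rfl
  | cons c cs ih =>
    intro p S
    have h1 : ∑ s ∈ S, pathSum (c :: cs) (p + Pi.single s 1) (S.erase s) =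
        ∑ s ∈ S, ∑ t ∈ S.erase s, c (p + Pi.single s 1) *
          pathSum cs (p + Pi.single s 1) ((S.erase s).erase t) := by
      have h0 := sum_erase_eq_zero_of_symm S (fun s t => c (p + Pi.single s 1 + Pi.single t 1) *
        pathSum cs (p + Pi.single s 1 + Pi.single t 1) ((S.erase s).erase t)) fun s t => by
          rw [add_right_comm, Finset.erase_right_comm]
      calc _ = ∑ s ∈ S, ∑ t ∈ S.erase s, (c (p + Pi.single s 1 + Pi.single t 1) *
              pathSum cs (p + Pi.single s 1 + Pi.single t 1) ((S.erase s).erase t) +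
            c (p + Pi.single s 1) *
              pathSum cs (p + Pi.single s 1 + Pi.single t 1) ((S.erase s).erase t)) := by
            simp only [pathSum, add_mul]
        _ = _ := by
            simp only [Finset.sum_add_distrib, h0, zero_add]
            refine Finset.sum_congr rfl fun s _ => ?_
            rw [← Finset.mul_sum, ← Finset.mul_sum, ih]
    have h2 : ∑ s ∈ S, pathSum (c :: cs) p (S.erase s) =
        ∑ s ∈ S, ∑ t ∈ S.erase s, c (p + Pi.single t 1) *
          pathSum cs (p + Pi.single t 1) ((S.erase s).erase t) := by
      have h0 : ∑ s ∈ S, ∑ t ∈ S.erase s,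
          c p * pathSum cs (p + Pi.single t 1) ((S.erase s).erase t) = 0 := by
        calc _ = ∑ s ∈ S, ∑ t ∈ S.erase s, c p * pathSum cs p ((S.erase s).erase t) := by
              refine Finset.sum_congr rfl fun s _ => ?_
              rw [← Finset.mul_sum, ← Finset.mul_sum, ih]
          _ = 0 := sum_erase_eq_zero_of_symm S _ fun s t => by rw [Finset.erase_right_comm]
      simp only [pathSum, add_mul, Finset.sum_add_distrib, h0, add_zero]
    rw [h1, h2, sum_erase_comm]
    refine Finset.sum_congr rfl fun s _ => Finset.sum_congr rfl fun t _ => ?_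
    rw [Finset.erase_right_comm]

/-- A path sum is a sum of differences over opposite faces of a unit cube. -/
theorem pathSum_cons (c : (ι → ℕ) → ZMod 2) (cs : List ((ι → ℕ) → ZMod 2)) (p : ι → ℕ)
    (S : Finset ι) : pathSum (c :: cs) p S =
      ∑ s ∈ S, (c (p + Pi.single s 1) * pathSum cs (p + Pi.single s 1) (S.erase s) +
        c p * pathSum cs p (S.erase s)) := by
  simp only [pathSum, add_mul, Finset.sum_add_distrib]
  rw [← Finset.mul_sum, ← Finset.mul_sum, sum_pathSum_erase]

/-- Paths that never move in direction `s` stay in the face, where `b s` is constant and its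
increment vanishes. -/
theorem pathSum_eq_zero_of_mem (b : ι → (ι → ℕ) → ZMod 2) (s : ι) (m : ℕ) (x : ZMod 2)
    (hb : ∀ p : ι → ℕ, p s = m → b s p = x) (l : List ι) (hs : s ∈ l) :
    ∀ (p : ι → ℕ) (S : Finset ι), s ∉ S → p s = m → pathSum (l.map b) p S = 0 := by
  induction l with
  | nil => simp at hs
  | cons j l ih =>
    intro p S hsS hp
    refine Finset.sum_eq_zero fun t ht => ?_
    have hst : s ≠ t := fun h => hsS (h ▸ ht)
    have hp' : (p + Pi.single t 1 : ι → ℕ) s = m := by simp [hst, hp]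
    by_cases hjs : s = j
    · subst hjs
      rw [hb _ hp', hb _ hp, CharTwo.add_self_eq_zero, zero_mul]
    · rw [ih ((List.mem_cons.1 hs).resolve_left hjs) _ _
        (fun h => hsS (Finset.mem_of_mem_erase h)) hp', mul_zero]

/-- A nonzero sum has a path along which every label changes at its own step. -/
theorem exists_ne_of_pathSum_ne_zero (b : ι → (ι → ℕ) → ZMod 2) (l : List ι) :
    ∀ (p : ι → ℕ) (S : Finset ι), pathSum (l.map b) p S ≠ 0 → ∀ i ∈ l, ∃ u v : ι → ℕ,
      (∀ j, p j ≤ u j ∧ u j ≤ p j + if j ∈ S then 1 else 0) ∧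
      (∀ j, p j ≤ v j ∧ v j ≤ p j + if j ∈ S then 1 else 0) ∧ b i u ≠ b i v := by
  induction l with
  | nil => simp
  | cons j l ih =>
    intro p S hne i hi
    obtain ⟨s, hs, hne⟩ := Finset.exists_ne_zero_of_sum_ne_zero hne
    have hstep : ∀ u : ι → ℕ, (∀ j, (p + Pi.single s 1 : ι → ℕ) j ≤ u j ∧
        u j ≤ (p + Pi.single s 1 : ι → ℕ) j + if j ∈ S.erase s then 1 else 0) →
        ∀ j, p j ≤ u j ∧ u j ≤ p j + if j ∈ S then 1 else 0 := by
      intro u hu j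
      have := hu j
      by_cases hjs : j = s
      · subst hjs
        simp only [Pi.add_apply, Pi.single_eq_same, Finset.mem_erase, ne_eq, not_true_eq_false,
          false_and, if_false, hs, if_true] at this ⊢
        omega
      · simpa [hjs] using this
    by_cases hij : i = j
    · subst hij
      refine ⟨p + Pi.single s 1, p, hstep _ fun j => ?_, fun j => ?_, fun h => ?_⟩
      · simp
      · simp
      · rw [h, CharTwo.add_self_eq_zero, zero_mul] at hne
        exact hne rfl
    · obtain ⟨u, v, hu, hv, huv⟩ := ih _ _ (right_ne_zero_of_mul hne) i
        ((List.mem_cons.1 hi).resolve_left hij)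
      exact ⟨u, v, hstep u hu, hstep v hv, huv⟩

variable {N : ℕ}

theorem boxSum_congr (l : List ι) : ∀ (q : ι → ℕ) (F G : (ι → ℕ) → ZMod 2),
    (∀ p : ι → ℕ, (∀ j ∉ l, p j = q j) → F p = G p) → boxSum N l q F = boxSum N l q G := by
  induction l with
  | nil => intro q F G h; exact h q fun _ _ => rfl
  | cons i l ih =>
    intro q F G h
    refine Finset.sum_congr rfl fun a _ => ih _ F G fun p hp => h p fun j hj => ?_
    rw [List.mem_cons, not_or] at hj
    rw [hp j hj.2, Function.update_of_ne hj.1]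

theorem boxSum_zero (l : List ι) : ∀ q : ι → ℕ, boxSum N l q (fun _ => 0) = 0 := by
  induction l with
  | nil => intro q; rfl
  | cons i l ih => intro q; exact Finset.sum_eq_zero fun a _ => ih _

theorem boxSum_add (l : List ι) : ∀ (q : ι → ℕ) (F G : (ι → ℕ) → ZMod 2),
    boxSum N l q (fun p => F p + G p) = boxSum N l q F + boxSum N l q G := by
  induction l with
  | nil => intro q F G; rfl
  | cons i l ih => intro q F G; simp only [boxSum, ih, Finset.sum_add_distrib]

theorem boxSum_sum (l : List ι) (q : ι → ℕ) (S : Finset ι) (F : ι → (ι → ℕ) → ZMod 2) :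
    boxSum N l q (fun p => ∑ s ∈ S, F s p) = ∑ s ∈ S, boxSum N l q (F s) := by
  induction S using Finset.induction_on with
  | empty => simpa using boxSum_zero l q
  | insert s S hs ih => simp only [Finset.sum_insert hs, boxSum_add, ih]

theorem boxSum_erase {s : ι} (l : List ι) (hs : s ∈ l) (hl : l.Nodup) : ∀ (q : ι → ℕ)
    (F : (ι → ℕ) → ZMod 2), boxSum N l q F =
      ∑ a ∈ Finset.range N, boxSum N (l.erase s) (Function.update q s a) F := by
  induction l with
  | nil => simp at hs
  | cons i l ih =>
    intro q F
    by_cases his : i = s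
    · subst his
      simp [boxSum]
    · rw [List.erase_cons_tail (by simpa using his)]
      simp only [boxSum]
      rw [Finset.sum_comm]
      refine Finset.sum_congr rfl fun a _ => ?_
      rw [ih ((List.mem_cons.1 hs).resolve_left (Ne.symm his)) (List.nodup_cons.1 hl).2]
      refine Finset.sum_congr rfl fun a' _ => ?_
      rw [Function.update_comm his]

theorem boxSum_shift {s : ι} (l : List ι) (hs : s ∉ l) : ∀ (q : ι → ℕ)
    (F : (ι → ℕ) → ZMod 2), boxSum N l q (fun p => F (p + Pi.single s 1)) =
      boxSum N l (q + Pi.single s 1) F := by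
  induction l with
  | nil => intro q F; rfl
  | cons i l ih =>
    intro q F
    rw [List.mem_cons, not_or] at hs
    refine Finset.sum_congr rfl fun a _ => ?_
    rw [ih hs.2]
    congr 1
    ext j
    by_cases hji : j = i
    · subst hji
      simp [Ne.symm hs.1]
    · simp [hji]

theorem boxSum_telescope {s : ι} (l : List ι) (hs : s ∈ l) (hl : l.Nodup) (q : ι → ℕ)
    (G : (ι → ℕ) → ZMod 2) : boxSum N l q (fun p => G (p + Pi.single s 1) + G p) =
      boxSum N (l.erase s) (Function.update q s N) G +
        boxSum N (l.erase s) (Function.update q s 0) G := by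
  have hs' : s ∉ l.erase s := hl.not_mem_erase
  rw [boxSum_erase l hs hl]
  have h : ∀ a, boxSum N (l.erase s) (Function.update q s a)
      (fun p => G (p + Pi.single s 1) + G p) =
      boxSum N (l.erase s) (Function.update q s (a + 1)) G -
        boxSum N (l.erase s) (Function.update q s a) G := by
    intro a
    rw [boxSum_add, boxSum_shift _ hs', CharTwo.sub_eq_add]
    congr 2
    ext j
    by_cases hj : j = s
    · subst hj
      simp
    · simp [hj]
  simp only [h]
  rw [Finset.sum_range_sub (fun a => boxSum N (l.erase s) (Function.update q s a) G),
    CharTwo.sub_eq_add]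

/-- Discrete Stokes: summing over the box leaves only its outer faces. For the head label `i`, the
face at `N` gives the same sum in one dimension less and the face at `0` gives zero; faces in any
other direction vanish by `pathSum_eq_zero_of_mem`. -/
theorem boxSum_pathSum_eq_one (b : ι → (ι → ℕ) → ZMod 2)
    (hb0 : ∀ i (p : ι → ℕ), p i = 0 → b i p = 0) (hb1 : ∀ i (p : ι → ℕ), p i = N → b i p = 1)
    (l : List ι) (hl : l.Nodup) : ∀ q : ι → ℕ,
      boxSum N l q (fun p => pathSum (l.map b) p l.toFinset) = 1 := by
  induction l with
  | nil => intro q; rfl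
  | cons i l ih =>
    intro q
    obtain ⟨hil, hl'⟩ := List.nodup_cons.1 hl
    simp only [List.map_cons, pathSum_cons]
    rw [boxSum_sum, Finset.sum_eq_single_of_mem i (by simp)]
    · rw [boxSum_telescope (G := fun p => b i p * pathSum (l.map b) p ((i :: l).toFinset.erase i))
        _ (by simp) hl]
      have he : (i :: l).toFinset.erase i = l.toFinset := by simp [hil]
      rw [he, List.erase_cons_head]
      have h1 : boxSum N l (Function.update q i N)
          (fun p => b i p * pathSum (l.map b) p l.toFinset) = 1 := by
        rw [← ih hl' (Function.update q i N)]
        refine boxSum_congr _ _ _ _ fun p hp => ?_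
        rw [hb1 i p (by simpa using hp i hil), one_mul]
      have h0 : boxSum N l (Function.update q i 0)
          (fun p => b i p * pathSum (l.map b) p l.toFinset) = 0 := by
        rw [← boxSum_zero l (Function.update q i 0)]
        refine boxSum_congr _ _ _ _ fun p hp => ?_
        rw [hb0 i p (by simpa using hp i hil), zero_mul]
      rw [h0, h1, add_zero]
    · intro s hs hsi
      have hsl : s ∈ l := by simpa [hsi] using hs
      have hsl' : s ∉ (i :: l).erase s := hl.not_mem_erase
      rw [boxSum_telescope (G := fun p => b i p * pathSum (l.map b) p ((i :: l).toFinset.erase s))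
        _ (by simpa using Or.inr hsl) hl]
      have hz : ∀ (m : ℕ) (x : ZMod 2), (∀ p : ι → ℕ, p s = m → b s p = x) →
          boxSum N ((i :: l).erase s) (Function.update q s m)
            (fun p => b i p * pathSum (l.map b) p ((i :: l).toFinset.erase s)) = 0 := by
        intro m x hx
        rw [← boxSum_zero ((i :: l).erase s) (Function.update q s m)]
        refine boxSum_congr _ _ _ _ fun p hp => ?_
        rw [pathSum_eq_zero_of_mem b s m x hx l hsl p _ (by simp) (by simpa using hp s hsl'),
          mul_zero]
      rw [hz N 1 (hb1 s), hz 0 0 (hb0 s), add_zero]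

theorem exists_boxSum_ne_zero (l : List ι) : ∀ (q : ι → ℕ) (F : (ι → ℕ) → ZMod 2),
    boxSum N l q F ≠ 0 → ∃ p, F p ≠ 0 := by
  intro q F h
  by_contra! hF
  refine h ?_
  rw [show F = fun _ => 0 from funext hF, boxSum_zero]

/-- Kuhn's cubical lemma: if each of the labels `b i` takes different constant values on the
opposite faces `p i = 0` and `p i = N`, then on some unit cube none of the labels is constant. -/
theorem exists_cube_forall_not_constant [Fintype ι] (b : ι → (ι → ℕ) → ZMod 2)
    (hb0 : ∀ i (p : ι → ℕ), p i = 0 → b i p = 0) (hb1 : ∀ i (p : ι → ℕ), p i = N → b i p = 1) :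
    ∃ p : ι → ℕ, ∀ i, ∃ u v : ι → ℕ, (∀ j, p j ≤ u j ∧ u j ≤ p j + 1) ∧
      (∀ j, p j ≤ v j ∧ v j ≤ p j + 1) ∧ b i u ≠ b i v := by
  have h := boxSum_pathSum_eq_one b hb0 hb1 (Finset.univ : Finset ι).toList
    (Finset.nodup_toList _) 0
  obtain ⟨p, hp⟩ := exists_boxSum_ne_zero _ _ _ (h.trans_ne one_ne_zero)
  refine ⟨p, fun i => ?_⟩
  obtain ⟨u, v, hu, hv, huv⟩ := exists_ne_of_pathSum_ne_zero b _ p _ hp i (by simp)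
  exact ⟨u, v, by simpa using hu, by simpa using hv, huv⟩

end PathSum

/-! ### Separating opposite faces of a cube -/

/-- The open separators of the pairs of opposite faces of a cube do not cover the cube. -/
theorem exists_forall_notMem_of_separate_faces {ι : Type*} [Fintype ι]
    {U V : ι → Set (ι → Icc (0 : ℝ) 1)} (hU : ∀ i, IsOpen (U i)) (hV : ∀ i, IsOpen (V i))
    (hUV : ∀ i, Disjoint (U i) (V i)) (h0 : ∀ i x, x i = 0 → x ∈ U i)
    (h1 : ∀ i x, x i = 1 → x ∈ V i) : ∃ x, ∀ i, x ∉ U i ∪ V i := by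
  classical
  by_contra! hcov
  obtain ⟨δ, hδ, hleb⟩ := lebesgue_number_lemma_of_metric
    (isCompact_univ (X := ι → Icc (0 : ℝ) 1)) (c := Sum.elim U V)
    (by rintro (i | i); exacts [hU i, hV i]) (by
      intro x _
      obtain ⟨i, hi | hi⟩ := hcov x
      · exact mem_iUnion.2 ⟨Sum.inl i, hi⟩
      · exact mem_iUnion.2 ⟨Sum.inr i, hi⟩)
  obtain ⟨n, hn⟩ := exists_nat_one_div_lt hδ
  have hn0 : (0 : ℝ) < n + 1 := by positivity
  -- Clamping by `projIcc` labels all of `ι → ℕ`, also beyond the grid.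
  let g : (ι → ℕ) → (ι → Icc (0 : ℝ) 1) := fun p i => projIcc 0 1 zero_le_one ((p i : ℝ) / (n + 1))
  let b : ι → (ι → ℕ) → ZMod 2 := fun i p => if g p ∈ U i then 0 else 1
  have hg0 : ∀ i (p : ι → ℕ), p i = 0 → g p i = 0 := fun i p hp => by
    simp only [g, hp]
    simp
  have hg1 : ∀ i (p : ι → ℕ), p i = n + 1 → g p i = 1 := fun i p hp => by
    simp only [g, hp]
    rw [Nat.cast_add, Nat.cast_one, div_self hn0.ne']
    exact projIcc_right (zero_le_one (α := ℝ))
  obtain ⟨p, hp⟩ := exists_cube_forall_not_constant (N := n + 1) b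
    (fun i p hp => if_pos (h0 i _ (hg0 i p hp)))
    (fun i p hp => if_neg fun h => disjoint_left.1 (hUV i) h (h1 i _ (hg1 i p hp)))
  have hnear : ∀ u : ι → ℕ, (∀ j, p j ≤ u j ∧ u j ≤ p j + 1) → g u ∈ Metric.ball (g p) δ := by
    intro u hu
    rw [Metric.mem_ball, dist_pi_lt_iff hδ]
    intro j
    refine lt_of_le_of_lt ?_ hn
    have h1 : dist (g u j) (g p j) ≤ dist ((u j : ℝ) / (n + 1)) ((p j : ℝ) / (n + 1)) := by
      simpa using (LipschitzWith.projIcc (a := (0 : ℝ)) (b := 1) zero_le_one).dist_le_mul _ _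
    refine h1.trans ?_
    rw [Real.dist_eq, ← sub_div, abs_div, abs_of_pos hn0]
    gcongr
    have h2 : (p j : ℝ) ≤ u j := by exact_mod_cast (hu j).1
    have h3 : (u j : ℝ) ≤ p j + 1 := by exact_mod_cast (hu j).2
    rw [abs_le]
    constructor <;> linarith
  -- The unit cube at `p` maps into a single `U j` or `V j`, so label `j` is constant on it,
  -- contrary to Kuhn's lemma.
  obtain ⟨j | j, hj⟩ := hleb (g p) (mem_univ _)
  · obtain ⟨u, v, hu, hv, huv⟩ := hp j
    refine huv ?_
    simp only [b]
    have hj' : Metric.ball (g p) δ ⊆ U j := hj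
    rw [if_pos (hj' (hnear u hu)), if_pos (hj' (hnear v hv))]
  · obtain ⟨u, v, hu, hv, huv⟩ := hp j
    refine huv ?_
    simp only [b]
    rw [if_neg fun h => disjoint_left.1 (hUV j) h (hj (hnear u hu)),
      if_neg fun h => disjoint_left.1 (hUV j) h (hj (hnear v hv))]

end ZeroDimensional

section HausdorffDimension

open Set Topology MeasureTheory Measure Filter
open scoped ENNReal NNReal

/-! ### Dimension of fibres and monotonicity in `n` -/

theorem exists_cover_of_hausdorffMeasure_eq_zero {Z : Type*} [MetricSpace Z] [MeasurableSpace Z]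
    [BorelSpace Z] {s : ℝ} {A : Set Z} (h : μH[s] A = 0) {r : ℝ≥0∞} (hr : 0 < r) :
    ∃ E : ℕ → Set Z, A ⊆ ⋃ i, E i ∧ (∀ i, Metric.ediam (E i) ≤ r) ∧
      ∑' i, ⨆ _ : (E i).Nonempty, Metric.ediam (E i) ^ s < r := by
  rw [hausdorffMeasure_apply] at h
  have h1 : ⨅ (t : ℕ → Set Z) (_ : A ⊆ ⋃ n, t n) (_ : ∀ n, Metric.ediam (t n) ≤ r),
      ∑' n, ⨆ _ : (t n).Nonempty, Metric.ediam (t n) ^ s < r := by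
    refine lt_of_le_of_lt ?_ hr
    rw [← h]
    exact le_iSup₂_of_le r hr le_rfl
  simp only [iInf_lt_iff] at h1
  obtain ⟨E, h2, h3, h4⟩ := h1
  exact ⟨E, h2, h3, h4⟩

/-- Almost all fibres of a `1`-Lipschitz function on a set of `(s + 1)`-dimensional Hausdorff
measure zero have `s`-dimensional Hausdorff measure zero. -/
theorem LipschitzWith.ae_hausdorffMeasure_fiber_eq_zero {Z : Type*} [MetricSpace Z]
    [MeasurableSpace Z] [BorelSpace Z] {f : Z → ℝ} (hf : LipschitzWith 1 f) {s : ℝ} (hs : 0 ≤ s)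
    (h : μH[s + 1] (univ : Set Z) = 0) : ∀ᵐ t : ℝ, μH[s] (f ⁻¹' {t}) = 0 := by
  have hr : ∀ n : ℕ, (0 : ℝ≥0∞) < 2⁻¹ ^ n := fun n => ENNReal.pow_pos (by simp) n
  choose E hE hEr hEs using fun n : ℕ => exists_cover_of_hausdorffMeasure_eq_zero h (hr n)
  -- `g n t` bounds the `s`-sum of a cover of the fibre over `t`. As `f (E n i)` has length at most
  -- the diameter of `E n i`, integration raises the exponent to `s + 1`. Closures ensure
  -- measurability.
  let g : ℕ → ℝ → ℝ≥0∞ := fun n t =>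
    ∑' i, (closure (f '' E n i)).indicator (fun _ => Metric.ediam (E n i) ^ s) t
  have hgm' : ∀ n i, Measurable
      ((closure (f '' E n i)).indicator (fun _ : ℝ => Metric.ediam (E n i) ^ s)) := fun n i =>
    measurable_const.indicator isClosed_closure.measurableSet
  have hgm : ∀ n, Measurable (g n) := fun n => Measurable.tsum (hgm' n)
  have hgi : ∀ n, ∫⁻ t, g n t ≤ 2⁻¹ ^ n := by
    intro n
    rw [lintegral_tsum fun i => (hgm' n i).aemeasurable]
    refine (ENNReal.tsum_le_tsum fun i => ?_).trans (hEs n).le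
    rw [lintegral_indicator isClosed_closure.measurableSet, setLIntegral_const]
    rcases (E n i).eq_empty_or_nonempty with he | hne
    · simp [he]
    · rw [ciSup_pos hne, ENNReal.rpow_add_of_nonneg _ _ hs zero_le_one, ENNReal.rpow_one]
      gcongr
      refine (Real.volume_le_diam _).trans ?_
      rw [Metric.ediam_closure]
      simpa using hf.ediam_image_le (E n i)
  have hsum : ∫⁻ t, ∑' n, g n t ≠ ∞ := by
    rw [lintegral_tsum fun n => (hgm n).aemeasurable]
    refine ne_top_of_le_ne_top ?_ (ENNReal.tsum_le_tsum hgi)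
    rw [ENNReal.tsum_geometric]
    simp
  filter_upwards [ae_lt_top (Measurable.tsum hgm) hsum] with t ht
  have hlim := ENNReal.tendsto_atTop_zero_of_tsum_ne_top ht.ne
  have hr0 : Tendsto (fun n : ℕ => (2⁻¹ : ℝ≥0∞) ^ n) atTop (𝓝 0) :=
    ENNReal.tendsto_pow_atTop_nhds_zero_of_lt_one (by simp)
  have hle := hausdorffMeasure_le_liminf_tsum (ι := fun n => {i // t ∈ closure (f '' E n i)}) s
    (f ⁻¹' {t}) _ hr0 (fun n i => E n i) (Eventually.of_forall fun n i => hEr n i)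
    (Eventually.of_forall fun n z hz => by
      obtain ⟨i, hi⟩ := mem_iUnion.1 (hE n (mem_univ z))
      have hz' : f z = t := hz
      exact mem_iUnion.2 ⟨⟨i, subset_closure ⟨z, hi, hz'⟩⟩, hi⟩)
  have heq : (fun n => ∑' i : {i // t ∈ closure (f '' E n i)}, Metric.ediam (E n i) ^ s) =
      fun n => g n t := by
    funext n
    rw [show (∑' i : {i // t ∈ closure (f '' E n i)}, Metric.ediam (E n i) ^ s) = _ from
      tsum_subtype {i | t ∈ closure (f '' E n i)} fun i => Metric.ediam (E n i) ^ s]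
    rfl
  rw [heq, hlim.liminf_eq] at hle
  exact le_antisymm hle zero_le

theorem LipschitzWith.ae_dimH_fiber_le {Z : Type*} [MetricSpace Z] {f : Z → ℝ}
    (hf : LipschitzWith 1 f) {δ : ℝ≥0} (hδ : dimH (univ : Set Z) = δ) :
    ∀ᵐ t : ℝ, (f ⁻¹' {t}).Nonempty →
      ((dimH (f ⁻¹' {t}) : ℝ≥0∞) : EReal) ≤ ((δ - 1 : ℝ) : EReal) := by
  borelize Z
  have key : ∀ s : ℝ≥0, δ < s + 1 → ∀ᵐ t : ℝ, μH[s] (f ⁻¹' {t}) = 0 := by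
    intro s hs
    refine hf.ae_hausdorffMeasure_fiber_eq_zero s.2 ?_
    have := hausdorffMeasure_of_dimH_lt (s := (univ : Set Z)) (d := s + 1)
      (by rw [hδ]; exact_mod_cast hs)
    simpa using this
  rcases lt_or_ge δ 1 with h | h
  -- The bound `δ - 1` is negative here, so almost all fibres must be empty: `μH[0]` of a nonempty
  -- set is at least `1`.
  · filter_upwards [key 0 (by simpa using h)] with t ht hne
    have := one_le_hausdorffMeasure_zero_of_nonempty hne
    simp only [NNReal.coe_zero] at ht
    simp [ht] at this
  · have hall : ∀ᵐ t : ℝ, ∀ m : ℕ,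
        μH[((δ - 1 + 1 / ((m : ℝ≥0) + 1) : ℝ≥0) : ℝ)] (f ⁻¹' {t}) = 0 := by
      refine ae_all_iff.2 fun m => key _ ?_
      rw [add_right_comm, tsub_add_cancel_of_le h]
      exact lt_add_of_pos_right _ (by positivity)
    filter_upwards [hall] with t ht _
    have hle : dimH (f ⁻¹' {t}) ≤ ((δ - 1 : ℝ≥0) : ℝ≥0∞) := by
      refine ENNReal.le_of_forall_pos_le_add fun ε hε _ => ?_
      obtain ⟨m, hm⟩ := exists_nat_one_div_lt hε
      have := dimH_le_of_hausdorffMeasure_ne_top (ne_of_eq_of_ne (ht m) ENNReal.zero_ne_top)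
      refine this.trans ?_
      rw [← ENNReal.coe_add]
      exact ENNReal.coe_le_coe.2 (by gcongr)
    refine (EReal.coe_ennreal_le_coe_ennreal_iff.2 hle).trans_eq ?_
    rw [← NNReal.coe_one, ← NNReal.coe_sub h]
    rfl

theorem hausdorffDim_coe_set {Z : Type*} [MetricSpace Z] {F : Set Z} (hF : F.Nonempty) :
    hausdorffDim F = ((dimH F : ℝ≥0∞) : EReal) := by
  rw [hausdorffDim, if_neg (not_isEmpty_iff.2 hF.to_subtype),
    ← (isometry_subtype_coe (s := F)).dimH_image, image_univ, Subtype.range_coe]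

/-- Apply the fibre bound to the distance from a point: arbitrarily small balls have frontiers of
dimension at most `δ - 1`. -/
theorem inductiveTopHausdorffDim_one_le (Z : Type*) [MetricSpace Z] :
    inductiveTopHausdorffDim 1 Z ≤ hausdorffDim Z := by
  rw [inductiveTopHausdorffDim]
  rcases isEmpty_or_nonempty Z with hZ | hZ
  · simp [hausdorffDim, hZ]
  rw [hausdorffDim, if_neg (not_isEmpty_iff.2 hZ), if_neg (not_isEmpty_iff.2 hZ)]
  by_cases htop : dimH (univ : Set Z) = ∞
  · simp [htop]
  obtain ⟨δ, hδ⟩ : ∃ δ : ℝ≥0, (δ : ℝ≥0∞) = dimH (univ : Set Z) := ⟨_, ENNReal.coe_toNNReal htop⟩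
  rw [← hδ]
  refine sInf_le ⟨{U | IsOpen U ∧ hausdorffDim (frontier U) ≤ ((δ - 1 : ℝ) : EReal)}, ?_, ?_⟩
  · refine TopologicalSpace.isTopologicalBasis_of_isOpen_of_nhds (fun U hU => hU.1) ?_
    intro x O hx hO
    obtain ⟨ε, hε, hball⟩ := Metric.isOpen_iff.1 hO x hx
    obtain ⟨r, hr, hr0, hrε⟩ := (dense_of_ae
      ((LipschitzWith.dist_left x).ae_dimH_fiber_le hδ.symm)).exists_between hε
    refine ⟨Metric.ball x r, ⟨Metric.isOpen_ball, ?_⟩, Metric.mem_ball_self hr0,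
      (Metric.ball_subset_ball hrε.le).trans hball⟩
    rcases (frontier (Metric.ball x r)).eq_empty_or_nonempty with he | hne
    · rw [hausdorffDim, if_pos (isEmpty_coe_sort.2 he)]
      have : (-1 : ℝ) ≤ δ - 1 := by linarith [δ.2]
      calc (-1 : EReal) = ((-1 : ℝ) : EReal) := by simp
        _ ≤ _ := EReal.coe_le_coe_iff.2 this
    · have hsub : frontier (Metric.ball x r) ⊆ (fun y => dist y x) ⁻¹' {r} :=
        Metric.frontier_ball_subset_sphere
      rw [hausdorffDim_coe_set hne]
      exact (EReal.coe_ennreal_le_coe_ennreal_iff.2 (dimH_mono hsub)).trans (hr (hne.mono hsub))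
  · intro U hU
    exact hU.2

theorem inductiveTopHausdorffDim_succ_le (n : ℕ) : ∀ (Z : Type*) [MetricSpace Z],
    inductiveTopHausdorffDim (n + 1) Z ≤ inductiveTopHausdorffDim n Z := by
  induction n with
  | zero => exact fun Z _ => inductiveTopHausdorffDim_one_le Z
  | succ n ih =>
    intro Z _
    rw [inductiveTopHausdorffDim, inductiveTopHausdorffDim]
    split_ifs with hZ
    · exact le_rfl
    · refine sInf_le_sInf ?_
      rintro d ⟨𝒰, h𝒰, hd⟩
      exact ⟨𝒰, h𝒰, fun U hU => (ih _).trans (hd U hU)⟩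

theorem inductiveTopHausdorffDim_antitone (Z : Type*) [MetricSpace Z] :
    Antitone fun n => inductiveTopHausdorffDim n Z :=
  antitone_nat_of_succ_le fun n => inductiveTopHausdorffDim_succ_le n Z

/-! ### Upper bound for the product with a cube -/

/-- Diameters may be zero; positive sizes `δ i` are needed to choose a grid of mesh about `δ i`. The
padding `η i ^ s⁻¹` costs only `η i` in the sum. -/
theorem exists_pos_cover_of_hausdorffMeasure_eq_zero {Z : Type*} [MetricSpace Z]
    [MeasurableSpace Z] [BorelSpace Z] {s : ℝ} (hs : 0 < s) {A : Set Z} (h : μH[s] A = 0)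
    {r : ℝ≥0∞} (hr : 0 < r) :
    ∃ (E : ℕ → Set Z) (δ : ℕ → ℝ≥0∞), A ⊆ ⋃ i, E i ∧ (∀ i, Metric.ediam (E i) ≤ δ i) ∧
      (∀ i, 0 < δ i) ∧ (∀ i, δ i ≤ r) ∧ ∑' i, δ i ^ s ≤ 2 * r := by
  obtain ⟨E, hE, hEr, hEs⟩ := exists_cover_of_hausdorffMeasure_eq_zero h hr
  obtain ⟨η, hη, hηr⟩ := ENNReal.exists_pos_sum_of_countable' hr.ne' ℕ
  refine ⟨E, fun i => max (Metric.ediam (E i)) (min (η i ^ s⁻¹) r), hE, fun i => le_max_left _ _,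
    fun i => lt_max_of_lt_right
      (lt_min (ENNReal.rpow_pos_of_nonneg (hη i) (inv_nonneg.2 hs.le)) hr),
    fun i => max_le (hEr i) (min_le_right _ _), ?_⟩
  calc _ ≤ ∑' i, ((⨆ _ : (E i).Nonempty, Metric.ediam (E i) ^ s) + η i) := by
        refine ENNReal.tsum_le_tsum fun i => ?_
        beta_reduce
        rcases max_choice (Metric.ediam (E i)) (min (η i ^ s⁻¹) r) with h | h
        · rw [h]
          refine le_add_right ?_
          rcases (E i).eq_empty_or_nonempty with he | hne
          · simp [he, hs]
          · rw [ciSup_pos hne]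
        · rw [h]
          refine le_add_left ?_
          calc _ ≤ (η i ^ s⁻¹) ^ s := ENNReal.rpow_le_rpow (min_le_left _ _) hs.le
            _ = η i := by rw [← ENNReal.rpow_mul, inv_mul_cancel₀ hs.ne', ENNReal.rpow_one]
    _ ≤ 2 * r := by
        rw [ENNReal.tsum_add, two_mul]
        exact add_le_add hEs.le hηr.le

/-- The cells of the subdivision of the cube into `m ^ n` cubes. -/
def gridCell {ι : Type*} (m : ℕ) (j : ι → Fin m) : Set (ι → Icc (0 : ℝ) 1) :=
  {y | ∀ l, (j l : ℝ) ≤ m * (y l : ℝ) ∧ m * (y l : ℝ) ≤ j l + 1}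

theorem exists_mem_gridCell {ι : Type*} {m : ℕ} (hm : 0 < m) (y : ι → Icc (0 : ℝ) 1) :
    ∃ j, y ∈ gridCell m j := by
  have h : ∀ l, ∃ a : Fin m, (a : ℝ) ≤ m * (y l : ℝ) ∧ m * (y l : ℝ) ≤ a + 1 := by
    intro l
    have hm' : (0 : ℝ) < m := by exact_mod_cast hm
    have h0 : 0 ≤ (m : ℝ) * (y l : ℝ) := mul_nonneg hm'.le (y l).2.1
    have h1 : (m : ℝ) * (y l : ℝ) ≤ m := mul_le_of_le_one_right hm'.le (y l).2.2
    rcases lt_or_ge ⌊(m : ℝ) * (y l : ℝ)⌋₊ m with h | h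
    · exact ⟨⟨_, h⟩, Nat.floor_le h0, (Nat.lt_floor_add_one _).le⟩
    · have h2 : (m : ℝ) ≤ m * (y l : ℝ) := (Nat.cast_le.2 h).trans (Nat.floor_le h0)
      -- Only the endpoint `y l = 1` reaches floor `m`; it belongs to the last cell.
      refine ⟨⟨m - 1, by omega⟩, ?_⟩
      simp only [Nat.cast_sub (Nat.succ_le_of_lt hm), Nat.cast_succ, Nat.cast_zero]
      constructor <;> linarith
  choose j hj using h
  exact ⟨j, hj⟩

theorem edist_le_of_mem_gridCell {ι : Type*} [Fintype ι] {m : ℕ} (hm : 0 < m) {j : ι → Fin m}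
    {y y' : ι → Icc (0 : ℝ) 1} (hy : y ∈ gridCell m j) (hy' : y' ∈ gridCell m j) :
    edist y y' ≤ ENNReal.ofReal (1 / m) := by
  have hm' : (0 : ℝ) < m := by exact_mod_cast hm
  refine edist_pi_le_iff.2 fun l => ?_
  rw [Subtype.edist_eq, edist_dist, Real.dist_eq]
  refine ENNReal.ofReal_le_ofReal ?_
  rw [le_div_iff₀ hm', mul_comm, ← Nat.abs_cast m, ← abs_mul, abs_le]
  constructor <;> linarith [(hy l).1, (hy l).2, (hy' l).1, (hy' l).2]

/-- Cut each `E × cube` into `m ^ card ι` cells with `1 / m ≤ δ` and `m * δ ≤ 2`; the cells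
contribute at most `2 ^ card ι * δ ^ s`. -/
theorem hausdorffMeasure_prod_cube_eq_zero {X ι : Type*} [MetricSpace X] [MeasurableSpace X]
    [BorelSpace X] [Fintype ι] [MeasurableSpace (X × (ι → Icc (0 : ℝ) 1))]
    [BorelSpace (X × (ι → Icc (0 : ℝ) 1))] {s : ℝ} (hs : 0 < s)
    (h : μH[s] (univ : Set X) = 0) :
    μH[s + Fintype.card ι] (univ : Set (X × (ι → Icc (0 : ℝ) 1))) = 0 := by
  have hr : ∀ n : ℕ, (0 : ℝ≥0∞) < 2⁻¹ ^ n := fun n => ENNReal.pow_pos (by simp) n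
  choose E δ hE hEδ hδ0 hδr hδs using fun n : ℕ =>
    exists_pos_cover_of_hausdorffMeasure_eq_zero hs h (hr n)
  have hδ1 : ∀ n i, δ n i ≤ 1 := fun n i => (hδr n i).trans (pow_le_one₀ zero_le (by simp))
  have hδtop : ∀ n i, δ n i ≠ ∞ := fun n i => ne_top_of_le_ne_top ENNReal.one_ne_top (hδ1 n i)
  have hδpos : ∀ n i, 0 < (δ n i).toReal := fun n i =>
    ENNReal.toReal_pos (hδ0 n i).ne' (hδtop n i)
  let m : ℕ → ℕ → ℕ := fun n i => ⌈1 / (δ n i).toReal⌉₊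
  have hm : ∀ n i, 0 < m n i := fun n i => Nat.ceil_pos.2 (one_div_pos.2 (hδpos n i))
  have hminv : ∀ n i, ENNReal.ofReal (1 / m n i) ≤ δ n i := fun n i => by
    rw [← ENNReal.ofReal_toReal (hδtop n i)]
    refine ENNReal.ofReal_le_ofReal ?_
    rw [one_div_le (by exact_mod_cast hm n i) (hδpos n i)]
    exact Nat.le_ceil _
  have hmδ : ∀ n i, (m n i : ℝ≥0∞) * δ n i ≤ 2 := fun n i => by
    have h1 : (δ n i).toReal ≤ 1 :=
      ENNReal.toReal_le_of_le_ofReal zero_le_one (by simpa using hδ1 n i)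
    have h2 : (m n i : ℝ) * (δ n i).toReal ≤ 2 := by
      have h3 : (m n i : ℝ) < 1 / (δ n i).toReal + 1 :=
        Nat.ceil_lt_add_one (one_div_pos.2 (hδpos n i)).le
      have h4 : 1 / (δ n i).toReal * (δ n i).toReal = 1 := one_div_mul_cancel (hδpos n i).ne'
      nlinarith [hδpos n i]
    have h5 := ENNReal.ofReal_le_ofReal h2
    rw [ENNReal.ofReal_mul (Nat.cast_nonneg _), ENNReal.ofReal_toReal (hδtop n i)] at h5
    simpa using h5
  let t : ∀ n : ℕ, (Σ i, ι → Fin (m n i)) → Set (X × (ι → Icc (0 : ℝ) 1)) := fun n x =>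
    E n x.1 ×ˢ gridCell (m n x.1) x.2
  have htd : ∀ n x, Metric.ediam (t n x) ≤ δ n x.1 := fun n x =>
    Metric.ediam_le fun z hz z' hz' => max_le ((Metric.edist_le_ediam_of_mem hz.1 hz'.1).trans
      (hEδ n x.1)) ((edist_le_of_mem_gridCell (hm n x.1) hz.2 hz'.2).trans (hminv n x.1))
  have hr0 : Tendsto (fun n : ℕ => (2⁻¹ : ℝ≥0∞) ^ n) atTop (𝓝 0) :=
    ENNReal.tendsto_pow_atTop_nhds_zero_of_lt_one (by simp)
  have hle := hausdorffMeasure_le_liminf_tsum (s + Fintype.card ι) univ _ hr0 t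
    (Eventually.of_forall fun n x => (htd n x).trans (hδr n x.1))
    (Eventually.of_forall fun n z _ => by
      obtain ⟨i, hi⟩ := mem_iUnion.1 (hE n (mem_univ z.1))
      obtain ⟨j, hj⟩ := exists_mem_gridCell (hm n i) z.2
      exact mem_iUnion.2 ⟨⟨i, j⟩, hi, hj⟩)
  have hsum : ∀ n, ∑' x, Metric.ediam (t n x) ^ (s + Fintype.card ι) ≤
      2 ^ Fintype.card ι * (2 * 2⁻¹ ^ n) := by
    intro n
    calc _ ≤ ∑' x : (Σ i, ι → Fin (m n i)), δ n x.1 ^ (s + Fintype.card ι) :=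
          ENNReal.tsum_le_tsum fun x => ENNReal.rpow_le_rpow (htd n x) (by positivity)
      _ = ∑' i, (m n i : ℝ≥0∞) ^ Fintype.card ι * δ n i ^ (s + Fintype.card ι) := by
          rw [ENNReal.tsum_sigma' fun x : (Σ i, ι → Fin (m n i)) => δ n x.1 ^ (s + Fintype.card ι)]
          refine tsum_congr fun i => ?_
          classical
          rw [tsum_fintype]
          simp
      _ ≤ ∑' i, 2 ^ Fintype.card ι * δ n i ^ s := by
          refine ENNReal.tsum_le_tsum fun i => ?_
          rw [ENNReal.rpow_add_of_nonneg _ _ hs.le (Nat.cast_nonneg _), ENNReal.rpow_natCast,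
            mul_left_comm, ← mul_pow, mul_comm]
          gcongr
          exact hmδ n i
      _ ≤ _ := by
          rw [ENNReal.tsum_mul_left]
          gcongr
          exact hδs n
  have hlim : Tendsto (fun n : ℕ => (2 : ℝ≥0∞) ^ Fintype.card ι * (2 * 2⁻¹ ^ n)) atTop (𝓝 0) := by
    have h1 := ENNReal.Tendsto.const_mul (a := 2) hr0 (Or.inr (by simp))
    have h2 := ENNReal.Tendsto.const_mul (a := 2 ^ Fintype.card ι) h1 (Or.inr (by simp))
    simpa using h2
  have hlim' := tendsto_of_tendsto_of_tendsto_of_le_of_le tendsto_const_nhds hlim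
    (fun n => zero_le) hsum
  rw [hlim'.liminf_eq] at hle
  exact le_antisymm hle zero_le

theorem dimH_prod_cube_le (X ι : Type*) [MetricSpace X] [Fintype ι] :
    dimH (univ : Set (X × (ι → Icc (0 : ℝ) 1))) ≤ dimH (univ : Set X) + Fintype.card ι := by
  borelize X
  borelize (X × (ι → Icc (0 : ℝ) 1))
  by_cases htop : dimH (univ : Set X) = ∞
  · simp [htop]
  obtain ⟨δ, hδ⟩ : ∃ δ : ℝ≥0, (δ : ℝ≥0∞) = dimH (univ : Set X) := ⟨_, ENNReal.coe_toNNReal htop⟩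
  refine ENNReal.le_of_forall_pos_le_add fun ε hε _ => ?_
  have h0 : μH[((δ + ε : ℝ≥0) : ℝ)] (univ : Set X) = 0 := by
    refine hausdorffMeasure_of_dimH_lt ?_
    rw [← hδ]
    exact ENNReal.coe_lt_coe.2 (lt_add_of_pos_right δ hε)
  have h1 := hausdorffMeasure_prod_cube_eq_zero (ι := ι)
    (NNReal.coe_pos.2 (add_pos_of_nonneg_of_pos zero_le hε)) h0
  have h2 : μH[((δ + ε + Fintype.card ι : ℝ≥0) : ℝ)]
      (univ : Set (X × (ι → Icc (0 : ℝ) 1))) ≠ ∞ := by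
    rw [NNReal.coe_add, NNReal.coe_natCast, h1]
    exact ENNReal.zero_ne_top
  refine (dimH_le_of_hausdorffMeasure_ne_top h2).trans_eq ?_
  rw [← hδ]
  push_cast
  ring

theorem hausdorffDim_L2Prod_unitCube_le (X : Type*) [MetricSpace X] [Nonempty X] (k : ℕ) :
    hausdorffDim (L2Prod X (UnitCube k)) ≤ hausdorffDim X + (k : EReal) := by
  let g : X × (Fin k → Icc (0 : ℝ) 1) → L2Prod X (UnitCube k) :=
    fun z => WithLp.toLp 2 (z.1, WithLp.toLp 2 z.2)
  have hg : LipschitzWith _ g := (WithLp.prod_lipschitzWith_toLp 2 X (UnitCube k)).comp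
    (LipschitzWith.prod_fst.prodMk
      ((PiLp.lipschitzWith_toLp 2 fun _ : Fin k => Icc (0 : ℝ) 1).comp LipschitzWith.prod_snd))
  have hsurj : Function.Surjective g := fun z => ⟨(z.fst, WithLp.ofLp z.snd), rfl⟩
  have hne : Nonempty (L2Prod X (UnitCube k)) := ⟨g (Classical.arbitrary X, fun _ => 0)⟩
  rw [hausdorffDim, if_neg (not_isEmpty_iff.2 hne), hausdorffDim,
    if_neg (not_isEmpty_iff.2 inferInstance)]
  have h1 := hg.dimH_range_le.trans (dimH_prod_cube_le X (Fin k))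
  rw [hsurj.range_eq, Fintype.card_fin] at h1
  have h2 := EReal.coe_ennreal_le_coe_ennreal_iff.2 h1
  rw [EReal.coe_ennreal_add] at h2
  have hk : ((k : ℝ≥0∞) : EReal) = k := rfl
  rwa [hk] at h2

/-! ### Lower bound and conclusion -/

theorem le_inductiveTopHausdorffDim_L2Prod_unitCube (X : Type*) [MetricSpace X]
    [TopologicalSpace.SeparableSpace X] [Nonempty X] (k : ℕ) :
    hausdorffDim X + (k : EReal) ≤ inductiveTopHausdorffDim k (L2Prod X (UnitCube k)) := by
  have : SecondCountableTopology X := UniformSpace.secondCountable_of_separable X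
  refine EReal.le_of_forall_lt_iff_le.1 fun d hd => ?_
  obtain ⟨A, C, hC, hAC, hA⟩ := exists_isZeroDimensional_decomposition k _ d hd
  let φ : L2Prod X (UnitCube k) → Fin k → Icc (0 : ℝ) 1 := fun z => WithLp.ofLp z.snd
  have hφ : Continuous φ :=
    (PiLp.continuous_ofLp 2 _).comp (WithLp.prod_lipschitzWith_ofLp 2 X (UnitCube k)).continuous.snd
  let Γ : Fin k → Icc (0 : ℝ) 1 → Set (L2Prod X (UnitCube k)) := fun i a => {z | φ z i = a}
  have hΓ : ∀ i a, IsClosed (Γ i a) := fun i a =>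
    isClosed_eq ((continuous_apply i).comp hφ) continuous_const
  have hΓd : ∀ i, Disjoint (Γ i 0) (Γ i 1) := fun i => disjoint_left.2 fun z h0 h1 =>
    zero_ne_one ((show φ z i = 0 from h0).symm.trans h1)
  choose U V hU hV hUV hΓU hΓV hCUV using fun i =>
    (hC i).exists_isOpen_separation (hΓ i 0) (hΓ i 1) (hΓd i)
  -- In the fibre over `x` some point avoids all `U i ∪ V i`, hence all `C i`, so it lies in `A`.
  have hproj : ∀ x : X, ∃ z ∈ A, z.fst = x := by
    intro x
    let ψ : (Fin k → Icc (0 : ℝ) 1) → L2Prod X (UnitCube k) :=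
      fun y => WithLp.toLp 2 (x, WithLp.toLp 2 y)
    have hψ : Continuous ψ := (WithLp.prod_lipschitzWith_toLp 2 X (UnitCube k)).continuous.comp
      (continuous_const.prodMk (PiLp.continuous_toLp 2 _))
    obtain ⟨y, hy⟩ := exists_forall_notMem_of_separate_faces (U := fun i => ψ ⁻¹' U i)
      (V := fun i => ψ ⁻¹' V i) (fun i => (hU i).preimage hψ) (fun i => (hV i).preimage hψ)
      (fun i => (hUV i).preimage ψ) (fun i y hy => hΓU i hy) (fun i y hy => hΓV i hy)
    refine ⟨ψ y, ?_, rfl⟩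
    have hmem : ψ y ∈ A ∪ ⋃ i, C i := hAC ▸ mem_univ _
    refine hmem.resolve_right fun h => ?_
    obtain ⟨i, hi⟩ := mem_iUnion.1 h
    exact hy i (hCUV i hi)
  have hne : A.Nonempty := by
    obtain ⟨z, hz, -⟩ := hproj (Classical.arbitrary X)
    exact ⟨z, hz⟩
  have hfst : LipschitzWith 1 fun z : L2Prod X (UnitCube k) => z.fst :=
    LipschitzWith.mk_one fun z w => WithLp.dist_fst_le z w
  have himage : (fun z : L2Prod X (UnitCube k) => z.fst) '' A = univ :=
    eq_univ_of_forall fun x => hproj x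
  have hX := hfst.dimH_image_le A
  rw [himage] at hX
  have hle := (EReal.coe_ennreal_le_coe_ennreal_iff.2 hX).trans (hA hne)
  rw [hausdorffDim, if_neg (not_isEmpty_iff.2 inferInstance)]
  refine (add_le_add_left hle (k : EReal)).trans_eq ?_
  have : d - k + k = d := by ring
  exact_mod_cast congrArg (Real.toEReal) this

end HausdorffDimension

theorem lemma5p2 {X : Type*} [MetricSpace X] [TopologicalSpace.SeparableSpace X] [Nonempty X]
    (n k : ℕ) (hnk : n ≤ k) :
    inductiveTopHausdorffDim n (L2Prod X (UnitCube k)) = hausdorffDim (L2Prod X (UnitCube k)) ∧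
      hausdorffDim (L2Prod X (UnitCube k)) = hausdorffDim X + (k : EReal) := by
  have h1 := le_inductiveTopHausdorffDim_L2Prod_unitCube X k
  have h2 := inductiveTopHausdorffDim_antitone (L2Prod X (UnitCube k)) hnk
  have h3 : inductiveTopHausdorffDim n (L2Prod X (UnitCube k)) ≤
      hausdorffDim (L2Prod X (UnitCube k)) :=
    inductiveTopHausdorffDim_antitone (L2Prod X (UnitCube k)) (Nat.zero_le n)
  have h4 := hausdorffDim_L2Prod_unitCube_le X k
  exact ⟨le_antisymm h3 (h4.trans (h1.trans h2)), le_antisymm h4 (h1.trans (h2.trans h3))⟩
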